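/- Let $K$ be a field, $S=K[x_1,\ldots,x_n]$ with the standard grading, and let $n\ge n_0>n_1>\cdots>n_m\ge 1$ be integers. Let $a_{ij}$ ($0\le i\le m$, $1\le j\le n_i$) be positive integers, and put $Q_i=(x_1^{a_{i1}},\ldots,x_{n_i}^{a_{in_i}})\subset S$ and $I_i=\bigcap_{j=i}^m Q_j$ for $0\le i\le m$. Assume that the decomposition $I_0=\bigcap_{j=0}^m Q_j$ is irredundant, i.e. no $Q_i$ contains $\bigcap_{j\ne i}Q_j$ (an empty intersection being $S$). For a nonzero homogeneous ideal $J\subset S$ let $\operatorname{reg}(J)=\max\{j-i : \beta_{ij}(J)\ne 0\}$ be its Castelnuovo–Mumford regularity, where the graded Betti number $\beta_{ij}(J)$ is the number of basis elements of degree $j$ in the $i$-th module $F_i$ of a minimal graded free resolution $\cdots\to F_1\to F_0\to J\to 0$. If $a_{ij}\ge a_{i+1,j}$ for all $0\le i<m$ and $1\le j\le n_{i+1}$, then $$\operatorname{reg}(I_i)=\operatorname{reg}(Q_i)=a_{i1}+a_{i2}+\cdots+a_{in_i}-n_i+1\qquad\text{for all } 0\le i\le m.$$ -/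

import Mathlib

namespace BorelType

/-- A minimal graded free resolution `⋯ → F₂ → F₁ → F₀ → I → 0` of an ideal `I` of
`S = K[x_1, …, x_n]` (standard grading), where `F_i = ⊕_k S(-deg i k)` has the basis
`e_k`, `k : Fin (rank i)`, with `e_k` homogeneous of degree `deg i k`. Degrees are natural numbers:
in a minimal resolution of an ideal no other degrees can occur. -/
structure MinimalGradedFreeResolution {K : Type*} [Field K] {n : ℕ}
    (I : Ideal (MvPolynomial (Fin n) K)) where
  /-- the rank of `F_i` -/
  rank : ℕ → ℕ
  /-- the degrees of the basis elements of `F_i` -/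
  deg : (i : ℕ) → Fin (rank i) → ℕ
  /-- the augmentation `F₀ → S`, with image `I` -/
  aug : (Fin (rank 0) → MvPolynomial (Fin n) K) →ₗ[MvPolynomial (Fin n) K]
    MvPolynomial (Fin n) K
  /-- the differential `F_{i+1} → F_i` -/
  d : (i : ℕ) → (Fin (rank (i + 1)) → MvPolynomial (Fin n) K) →ₗ[MvPolynomial (Fin n) K]
    (Fin (rank i) → MvPolynomial (Fin n) K)
  /-- `F₀ → S` has image `I` -/
  range_aug : LinearMap.range aug = I
  /-- exactness at `F₀` -/
  exact_zero : LinearMap.range (d 0) = LinearMap.ker aug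
  /-- exactness at `F_{i+1}` -/
  exact_succ : ∀ i, LinearMap.range (d (i + 1)) = LinearMap.ker (d i)
  /-- `F₀ → S` is homogeneous of degree `0` -/
  aug_homogeneous : ∀ k, ∀ u ∈ (aug (Pi.single k 1)).support, u.degree = deg 0 k
  /-- `F_{i+1} → F_i` is homogeneous of degree `0`: every monomial in the `(l, k)` entry of its
  matrix has degree `deg e_k - deg e_l` -/
  d_homogeneous : ∀ i k l, ∀ u ∈ (d i (Pi.single k 1) l).support,
    u.degree + deg i l = deg (i + 1) k
  /-- minimality: the entries of the matrices lie in the ideal `(x_1, …, x_n)` -/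
  minimal : ∀ i k l, MvPolynomial.constantCoeff (d i (Pi.single k 1) l) = 0

/-- The graded Betti number `β_{ij}`, read off a minimal graded free resolution: the number
of basis elements of degree `j` in `F_i`. -/
noncomputable def MinimalGradedFreeResolution.betti {K : Type*} [Field K] {n : ℕ}
    {I : Ideal (MvPolynomial (Fin n) K)} (F : MinimalGradedFreeResolution I) (i j : ℕ) : ℕ :=
  (Finset.univ.filter fun k : Fin (F.rank i) => F.deg i k = j).card

/-- `reg(I) = r`, where `reg(I) = max {j - i : β_{ij}(I) ≠ 0}`. A minimal graded
free resolution exists, and the maximum, taken in any of them, exists and equals `r`. -/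
def HasRegularity {K : Type*} [Field K] {n : ℕ} (I : Ideal (MvPolynomial (Fin n) K))
    (r : ℤ) : Prop :=
  Nonempty (MinimalGradedFreeResolution I) ∧
    ∀ F : MinimalGradedFreeResolution I,
      IsGreatest {e : ℤ | ∃ i j : ℕ, F.betti i j ≠ 0 ∧ e = (j : ℤ) - (i : ℤ)} r

/-- The irreducible monomial ideal `Q = (x_1^{a_1}, …, x_r^{a_r})` of `K[x_1, …, x_n]`. The
variable `x_{j+1}` is `X j` for `j : Fin n`, and only the exponents `a j` with `j < r` matter. -/
noncomputable def irredIdeal (K : Type*) [Field K] {n : ℕ} (r : ℕ) (a : Fin n → ℕ) :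
    Ideal (MvPolynomial (Fin n) K) :=
  Ideal.span {p | ∃ j : Fin n, (j : ℕ) < r ∧ p = MvPolynomial.X j ^ a j}

/-- `I_i = ⋂_{j ≥ i} Q_j`. -/
noncomputable def tailInter {R : Type*} [CommRing R] {m : ℕ} (Q : Fin (m + 1) → Ideal R)
    (i : Fin (m + 1)) : Ideal R :=
  ⨅ j : Fin (m + 1), ⨅ _ : i ≤ j, Q j

/-- The intersection of the `Q_j` is irredundant: no `Q_i` contains the intersection
of the others. -/
def Irredundant {R : Type*} [CommRing R] {m : ℕ} (Q : Fin (m + 1) → Ideal R) : Prop :=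
  ∀ i : Fin (m + 1), ¬ (⨅ j : Fin (m + 1), ⨅ _ : j ≠ i, Q j) ≤ Q i

end BorelType

/-!
The Betti number `β_{p, p + q}(I)` is the dimension of the Koszul homology of `I` with respect to
the variables in homological degree `p` and internal degree `p + q`: pass along a minimal
resolution from each syzygy module to the next, using that the Koszul complex of `S` is exact in
positive degrees.

Let `Q = (x_j ^ a_j : j ∈ T)`, let `I` be a monomial ideal whose membership does not depend on the
variables outside `T`, and put `ρ = ∑ j ∈ T, (a_j - 1) + 1`. Division by `x_k` is a homotopy
contracting the Koszul complex onto its part free of `x_k` and `e_k`. Applied for all `k ∉ T`, it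
leaves in the complex of `I / (I ∩ Q)` only coefficient monomials dividing the socle monomial
`∏ j ∈ T, x_j ^ (a_j - 1)`, of degree `ρ - 1`. Hence `I` and `I ∩ Q` have the same Koszul homology
in coefficient degrees `q > ρ`. If the socle monomial lies in `I`, its product with the wedge of
the `e_j`, `j ∈ T`, is a cycle modulo `I ∩ Q`, and its boundary is a nonzero class with `q = ρ`. So
`reg (I ∩ Q) = max ρ (reg I)`. For `I = I_{i + 1}` and `Q = Q_i`, irredundancy puts the socle
monomial into `I`.
-/

namespace BorelType

open MvPolynomial

section GradedModules

variable {σ R ι κ : Type*} [CommRing R]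

local notation "S" => MvPolynomial σ R

/-- An element of the free module `⊕ l, S(-deg l)` is homogeneous of degree `j`. -/
def IsHomogeneousElt (deg : ι → ℕ) (j : ℕ) (m : ι → S) : Prop :=
  ∀ l, ∀ u ∈ (m l).support, u.degree + deg l = j

/-- A map `⊕ k, S(-deg' k) → ⊕ l, S(-deg l)` of graded free modules is homogeneous of
degree `0`. -/
def IsHomogeneousMap [DecidableEq κ] (deg' : κ → ℕ) (deg : ι → ℕ)
    (f : (κ → S) →ₗ[S] (ι → S)) : Prop :=
  ∀ k, IsHomogeneousElt deg (deg' k) (f (Pi.single k 1))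

/-- The projection of the free module `⊕ l, S(-deg l)` onto its component of degree `j`. -/
noncomputable def gradedPart (deg : ι → ℕ) (j : ℕ) : (ι → S) →ₗ[R] (ι → S) :=
  LinearMap.pi fun l =>
    (if deg l ≤ j then homogeneousComponent (j - deg l) else 0) ∘ₗ LinearMap.proj l

/-- A submodule of the free module `⊕ l, S(-deg l)` is graded. -/
def IsGraded (deg : ι → ℕ) (B : Submodule S (ι → S)) : Prop :=
  ∀ j, ∀ m ∈ B, gradedPart deg j m ∈ B

/-- The elements of a submodule of a free module have no constant terms. For a syzygy module this
is the minimality of the generators. -/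
def NoConstantTerm (B : Submodule S (ι → S)) : Prop :=
  ∀ m ∈ B, ∀ l, constantCoeff (m l) = 0

variable {deg : ι → ℕ} {deg' : κ → ℕ}

theorem coeff_gradedPart (deg : ι → ℕ) (j : ℕ) (m : ι → S) (l : ι) (u : σ →₀ ℕ) :
    coeff u (gradedPart deg j m l) = if u.degree + deg l = j then coeff u (m l) else 0 := by
  simp only [gradedPart, LinearMap.pi_apply, LinearMap.comp_apply, LinearMap.proj_apply]
  split_ifs with h h' h' <;> simp [coeff_homogeneousComponent] <;> omega

theorem gradedPart_apply_self (deg : ι → ℕ) (m : ι → S) (l : ι) :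
    gradedPart deg (deg l) m l = C (constantCoeff (m l)) := by
  simp [gradedPart, homogeneousComponent_zero, constantCoeff_eq]

theorem isHomogeneousElt_gradedPart (deg : ι → ℕ) (j : ℕ) (m : ι → S) :
    IsHomogeneousElt deg j (gradedPart deg j m) := by
  intro l u hu
  rw [mem_support_iff, coeff_gradedPart] at hu
  by_contra h
  exact hu (if_neg h)

theorem IsHomogeneousElt.gradedPart_eq {j : ℕ} {m : ι → S} (hm : IsHomogeneousElt deg j m)
    (q : ℕ) : gradedPart deg q m = if j = q then m else 0 := by
  ext l u
  rw [coeff_gradedPart]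
  by_cases hu : coeff u (m l) = 0
  · split_ifs <;> simp [hu]
  · rw [hm l u (mem_support_iff.2 hu)]
    split_ifs <;> simp

theorem gradedPart_gradedPart (deg : ι → ℕ) (j q : ℕ) (m : ι → S) :
    gradedPart deg q (gradedPart deg j m) = if j = q then gradedPart deg j m else 0 :=
  (isHomogeneousElt_gradedPart deg j m).gradedPart_eq q

theorem exists_sum_gradedPart [Finite ι] (deg : ι → ℕ) (m : ι → S) :
    ∃ J : Finset ℕ, m = ∑ j ∈ J, gradedPart deg j m := by
  classical
  have := Fintype.ofFinite ι
  refine ⟨Finset.univ.biUnion fun l => (m l).support.image fun u => u.degree + deg l, ?_⟩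
  ext l u
  rw [Finset.sum_apply, coeff_sum]
  simp only [coeff_gradedPart, Finset.sum_ite_eq]
  by_cases hu : coeff u (m l) = 0
  · simp [hu]
  · exact (if_pos (Finset.mem_biUnion.2 ⟨l, Finset.mem_univ _,
      Finset.mem_image_of_mem _ (mem_support_iff.2 hu)⟩)).symm

theorem gradedPart_X_smul (deg : ι → ℕ) (j : ℕ) (k : σ) (m : ι → S) :
    gradedPart deg (j + 1) ((X k : S) • m) = (X k : S) • gradedPart deg j m := by
  classical
  ext l u
  simp only [coeff_gradedPart, Pi.smul_apply, smul_eq_mul, coeff_X_mul']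
  by_cases hk : k ∈ u.support
  · obtain ⟨v, rfl⟩ : ∃ v, u = v + Finsupp.single k 1 :=
      ⟨_, (tsub_add_cancel_of_le (Finsupp.single_le_iff.2
        (Nat.one_le_iff_ne_zero.2 (Finsupp.mem_support_iff.1 hk)))).symm⟩
    simp only [hk, if_true, add_tsub_cancel_right, map_add, Finsupp.degree_single,
      add_right_comm _ 1, add_left_inj]
  · simp only [hk, if_false, ite_self]

theorem isHomogeneousElt_single [DecidableEq ι] (deg : ι → ℕ) (k : ι) :
    IsHomogeneousElt deg (deg k) (Pi.single k 1 : ι → S) := by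
  classical
  intro l u hu
  obtain rfl | hl := eq_or_ne l k
  · rw [Pi.single_eq_same, mem_support_iff, coeff_one] at hu
    obtain rfl : 0 = u := of_not_not fun h => hu (if_neg h)
    simp
  · simp [Pi.single_eq_of_ne hl] at hu

theorem IsHomogeneousElt.gradedPart_smul {d : ℕ} {b : ι → S} (hb : IsHomogeneousElt deg d b)
    (j : ℕ) (g : S) :
    gradedPart deg j (g • b) = (if d ≤ j then homogeneousComponent (j - d) g else 0) • b := by
  classical
  ext l u
  have coeff_component (v : σ →₀ ℕ) :
      coeff v (if d ≤ j then homogeneousComponent (j - d) g else 0) =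
        if v.degree + d = j then coeff v g else 0 := by
    split_ifs <;> simp [coeff_homogeneousComponent] <;> omega
  simp only [coeff_gradedPart, Pi.smul_apply, smul_eq_mul, coeff_mul, coeff_component]
  have summand_eq : ∀ x ∈ Finset.HasAntidiagonal.antidiagonal u,
      (if x.1.degree + d = j then coeff x.1 g else 0) * coeff x.2 (b l) =
        if u.degree + deg l = j then coeff x.1 g * coeff x.2 (b l) else 0 := by
    intro x hx
    obtain hx₂ | hx₂ := eq_or_ne (coeff x.2 (b l)) 0
    · simp [hx₂]
    · have hd : x.2.degree + deg l = d := hb l x.2 (mem_support_iff.2 hx₂)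
      rw [← Finset.HasAntidiagonal.mem_antidiagonal.1 hx, map_add, add_assoc, hd, ite_mul, zero_mul]
  rw [Finset.sum_congr rfl summand_eq, Finset.sum_ite_irrel, Finset.sum_const_zero]

theorem IsHomogeneousMap.map_gradedPart [Finite κ] [DecidableEq κ] {f : (κ → S) →ₗ[S] (ι → S)}
    (hf : IsHomogeneousMap deg' deg f) (j : ℕ) (m : κ → S) :
    f (gradedPart deg' j m) = gradedPart deg j (f m) := by
  suffices f.restrictScalars R ∘ₗ gradedPart deg' j = gradedPart deg j ∘ₗ f.restrictScalars R from
    LinearMap.congr_fun this m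
  refine LinearMap.pi_ext fun k g => ?_
  have single_eq : Pi.single k g = g • (Pi.single k 1 : κ → S) := by simp [← Pi.single_smul]
  simp only [LinearMap.comp_apply, LinearMap.restrictScalars_apply, single_eq, map_smul,
    (isHomogeneousElt_single deg' k).gradedPart_smul, (hf k).gradedPart_smul]

theorem IsHomogeneousMap.isGraded_ker [Finite κ] [DecidableEq κ] {f : (κ → S) →ₗ[S] (ι → S)}
    (hf : IsHomogeneousMap deg' deg f) : IsGraded deg' (LinearMap.ker f) := by
  intro j m hm
  rw [LinearMap.mem_ker] at hm ⊢
  rw [hf.map_gradedPart, hm, map_zero]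

end GradedModules

section KoszulComplex

variable {σ : Type*} [LinearOrder σ]

/-- The sign with which `e k` enters the wedge product `e A` in the Koszul complex. -/
def koszulSign (k : σ) (A : Finset σ) : ℤ :=
  (-1) ^ (A.filter (· < k)).card

theorem koszulSign_mul_self (k : σ) (A : Finset σ) : koszulSign k A * koszulSign k A = 1 := by
  rw [koszulSign, ← mul_pow, neg_one_mul, neg_neg, one_pow]

theorem koszulSign_insert {k : σ} {A : Finset σ} (hk : k ∉ A) (l : σ) :
    koszulSign l (insert k A) = if k < l then -koszulSign l A else koszulSign l A := by
  rw [koszulSign, koszulSign, Finset.filter_insert]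
  split_ifs
  · rw [Finset.card_insert_of_notMem (fun h => hk (Finset.mem_filter.1 h).1), pow_succ,
      mul_neg_one]
  · rfl

variable {k l : σ} {A : Finset σ}

theorem koszulSign_mul_insert (hk : k ∉ A) (hl : l ∉ A) (hkl : k ≠ l) :
    koszulSign k A * koszulSign l (insert k A) = -(koszulSign l A * koszulSign k (insert l A)) := by
  rw [koszulSign_insert hk, koszulSign_insert hl]
  obtain h | h := lt_or_gt_of_ne hkl <;> simp only [h, h.asymm, if_true, if_false] <;> ring

theorem koszulSign_insert_mul_insert (hk : k ∉ A) (hl : l ∉ A) (hkl : k ≠ l) :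
    koszulSign l (insert k A) * koszulSign k (insert l A) = -(koszulSign k A * koszulSign l A) := by
  rw [koszulSign_insert hk, koszulSign_insert hl]
  obtain h | h := lt_or_gt_of_ne hkl <;> simp only [h, h.asymm, if_true, if_false] <;> ring

variable [Fintype σ] {S M M' : Type*} [CommRing S] [AddCommGroup M] [Module S M]
  [AddCommGroup M'] [Module S M']

/-- The differential of the Koszul complex of a family `x` of ring elements with coefficients in
a module `M`. A chain is given by its coefficients at the wedge products
`e k₁ ∧ ⋯ ∧ e kₚ`, `k₁ < ⋯ < kₚ`, which are indexed by the sets `{k₁, …, kₚ}`; all homological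
degrees are treated at once. -/
def koszulD (x : σ → S) : (Finset σ → M) →ₗ[S] (Finset σ → M) :=
  LinearMap.pi fun A => ∑ k ∈ Aᶜ, koszulSign k A • x k • LinearMap.proj (insert k A)

theorem koszulD_apply (x : σ → S) (z : Finset σ → M) (A : Finset σ) :
    koszulD x z A = ∑ k ∈ Aᶜ, koszulSign k A • x k • z (insert k A) := by
  simp [koszulD]

theorem koszulD_koszulD (x : σ → S) (z : Finset σ → M) : koszulD x (koszulD x z) = 0 := by
  ext A
  simp only [koszulD_apply, Finset.smul_sum, Pi.zero_apply]
  rw [Finset.sum_sigma']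
  have mem_iff (p : Σ _ : σ, σ) : (p ∈ Aᶜ.sigma fun k => (insert k A)ᶜ) ↔
      p.1 ∉ A ∧ p.2 ∉ A ∧ p.1 ≠ p.2 := by
    simp only [Finset.mem_sigma, Finset.mem_compl, Finset.mem_insert, not_or, ne_comm (a := p.1)]
    tauto
  refine Finset.sum_involution (fun p _ => ⟨p.2, p.1⟩) (fun p hp => ?_)
    (fun p hp _ h => ((mem_iff p).1 hp).2.2 (congrArg Sigma.fst h).symm)
    (fun p hp => ?_) (fun _ _ => rfl)
  · obtain ⟨hk, hl, hkl⟩ := (mem_iff p).1 hp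
    have collect (s t : ℤ) (a b : S) (m : M) : s • a • t • b • m = (s * t) • (a * b) • m := by
      rw [smul_comm a t, smul_smul, smul_smul]
    rw [Finset.insert_comm p.2 p.1, collect, collect, mul_comm (x p.2), ← add_smul,
      koszulSign_mul_insert hk hl hkl, neg_add_cancel, zero_smul]
  · obtain ⟨hk, hl, hkl⟩ := (mem_iff p).1 hp
    exact (mem_iff _).2 ⟨hl, hk, hkl.symm⟩

theorem koszulD_mem (x : σ → S) {B : Submodule S M} {z : Finset σ → M} (hz : ∀ A, z A ∈ B)
    (A : Finset σ) : koszulD x z A ∈ B := by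
  rw [koszulD_apply]
  exact B.sum_mem fun k _ => zsmul_mem (B.smul_mem _ (hz _)) _

theorem koszulD_comp (x : σ → S) (f : M →ₗ[S] M') (z : Finset σ → M) :
    koszulD x (f ∘ z) = f ∘ koszulD x z := by
  ext A
  simp only [koszulD_apply, Function.comp_apply, map_sum, map_zsmul, map_smul]

end KoszulComplex

section Bihomogeneous

variable {σ R ι κ : Type*} [CommRing R]

local notation "S" => MvPolynomial σ R

/-- The component of a Koszul chain with coefficients in a graded free module, of homological
degree `p` and of coefficient degree `q`. Its internal degree is `p + q`. -/
noncomputable def bihomPart (deg : ι → ℕ) (p q : ℕ) (z : Finset σ → ι → S) : Finset σ → ι → S :=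
  fun A => if A.card = p then gradedPart deg q (z A) else 0

variable {deg : ι → ℕ} {deg' : κ → ℕ} {p q : ℕ}

theorem bihomPart_of_card_ne {z : Finset σ → ι → S} {A : Finset σ} (hA : A.card ≠ p) :
    bihomPart deg p q z A = 0 :=
  if_neg hA

theorem bihomPart_bihomPart (deg : ι → ℕ) (p q : ℕ) (z : Finset σ → ι → S) :
    bihomPart deg p q (bihomPart deg p q z) = bihomPart deg p q z := by
  funext A
  unfold bihomPart
  split_ifs
  · rw [gradedPart_gradedPart, if_pos rfl]
  · rfl

theorem bihomPart_sub (deg : ι → ℕ) (p q : ℕ) (z w : Finset σ → ι → S) :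
    bihomPart deg p q (z - w) = bihomPart deg p q z - bihomPart deg p q w := by
  funext A
  simp only [bihomPart, Pi.sub_apply, map_sub]
  split_ifs
  · rfl
  · rw [sub_zero]

theorem bihomPart_mem {B : Submodule S (ι → S)} (hB : IsGraded deg B)
    {z : Finset σ → ι → S} (hz : ∀ A, z A ∈ B)
    (A : Finset σ) : bihomPart deg p q z A ∈ B := by
  unfold bihomPart
  split_ifs
  · exact hB q _ (hz A)
  · exact B.zero_mem

theorem bihomPart_comp [Finite κ] [DecidableEq κ] {f : (κ → S) →ₗ[S] (ι → S)}
    (hf : IsHomogeneousMap deg' deg f) (z : Finset σ → κ → S) :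
    bihomPart deg p q (f ∘ z) = f ∘ bihomPart deg' p q z := by
  funext A
  simp only [bihomPart, Function.comp_apply]
  split_ifs
  · rw [hf.map_gradedPart]
  · rw [map_zero]

variable [LinearOrder σ] [Fintype σ]

local notation "∂" => koszulD (X : σ → S)

theorem koszulD_bihomPart_succ (deg : ι → ℕ) (p q : ℕ) (z : Finset σ → ι → S) :
    ∂ (bihomPart deg (p + 1) q z) = bihomPart deg p (q + 1) (∂ z) := by
  funext A
  have card_insert {k : σ} (hk : k ∈ Aᶜ) : (insert k A).card = A.card + 1 :=
    Finset.card_insert_of_notMem (Finset.mem_compl.1 hk)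
  by_cases hA : A.card = p
  · rw [bihomPart, if_pos hA, koszulD_apply, koszulD_apply, map_sum]
    refine Finset.sum_congr rfl fun k hk => ?_
    rw [bihomPart, if_pos (by rw [card_insert hk, hA]), map_zsmul, gradedPart_X_smul]
  · rw [bihomPart_of_card_ne hA, koszulD_apply]
    refine Finset.sum_eq_zero fun k hk => ?_
    rw [bihomPart_of_card_ne (by rw [card_insert hk]; omega), smul_zero, smul_zero]

theorem koszulD_bihomPart_zero (deg : ι → ℕ) (q : ℕ) (z : Finset σ → ι → S) :
    ∂ (bihomPart deg 0 q z) = 0 := by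
  funext A
  rw [koszulD_apply]
  refine Finset.sum_eq_zero fun k _ => ?_
  rw [bihomPart_of_card_ne (Finset.card_ne_zero_of_mem (Finset.mem_insert_self k A)), smul_zero,
    smul_zero]

theorem koszulD_bihomPart_eq_zero (p q : ℕ) {z : Finset σ → ι → S} (hz : ∂ z = 0) :
    ∂ (bihomPart deg p q z) = 0 := by
  cases p with
  | zero => exact koszulD_bihomPart_zero deg q z
  | succ p =>
    funext A
    simp [koszulD_bihomPart_succ, hz, bihomPart]

end Bihomogeneous

section DivisionByVariable

variable {σ R ι : Type*} [CommRing R]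

local notation "S" => MvPolynomial σ R

/-- Division of every entry by the variable `X k`, discarding the terms not divisible by it. -/
noncomputable def divVar (k : σ) : (ι → S) →+ (ι → S) where
  toFun m l := (m l).divMonomial (Finsupp.single k 1)
  map_zero' := funext fun _ => zero_divMonomial _
  map_add' _ _ := funext fun _ => add_divMonomial _ _ _

/-- The part of every entry which consists of the terms not divisible by the variable `X k`. -/
noncomputable def modVar (k : σ) (m : ι → S) : ι → S :=
  fun l => (m l).modMonomial (Finsupp.single k 1)

theorem coeff_modVar (k : σ) (m : ι → S) (l : ι) (u : σ →₀ ℕ) :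
    coeff u (modVar k m l) = if u k = 0 then coeff u (m l) else 0 := by
  unfold modVar
  split_ifs with h
  · exact coeff_modMonomial_of_not_le _ (by simp [Finsupp.single_le_iff, h])
  · exact coeff_modMonomial_of_le _ (Finsupp.single_le_iff.2 (Nat.one_le_iff_ne_zero.2 h))

theorem X_smul_divVar_add_modVar (k : σ) (m : ι → S) : (X k : S) • divVar k m + modVar k m = m :=
  funext fun l => divMonomial_add_modMonomial_single (m l) k

theorem divVar_X_smul (k : σ) (m : ι → S) : divVar k ((X k : S) • m) = m :=
  funext fun l => X_mul_divMonomial k (m l)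

theorem divVar_X_smul_of_ne {k l : σ} (h : k ≠ l) (m : ι → S) :
    divVar k ((X l : S) • m) = (X l : S) • divVar k m := by
  classical
  ext i u
  change coeff u ((X l * m i).divMonomial _) = coeff u (X l * (m i).divMonomial _)
  have apply_l : (Finsupp.single k 1 + u : σ →₀ ℕ) l = u l := by simp [h]
  rw [coeff_divMonomial, coeff_X_mul', coeff_X_mul']
  simp only [Finsupp.mem_support_iff, apply_l]
  split_ifs with hl
  · rw [coeff_divMonomial, add_tsub_assoc_of_le]
    exact Finsupp.single_le_iff.2 (Nat.one_le_iff_ne_zero.2 hl)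
  · rfl

end DivisionByVariable

section Homotopy

variable {σ R ι : Type*} [LinearOrder σ] [CommRing R]

local notation "S" => MvPolynomial σ R

/-- The homotopy of the Koszul complex of the variables given by division by `X k`. -/
noncomputable def koszulHomotopy (k : σ) (z : Finset σ → ι → S) : Finset σ → ι → S :=
  fun A => if k ∈ A then koszulSign k (A.erase k) • divVar k (z (A.erase k)) else 0

/-- The part of a Koszul chain which involves neither the variable `X k` nor the corresponding
basis element of the exterior algebra. -/
noncomputable def omitVar (k : σ) (z : Finset σ → ι → S) : Finset σ → ι → S :=
  fun A => if k ∈ A then 0 else modVar k (z A)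

theorem koszulHomotopy_insert {k : σ} {A : Finset σ} (hk : k ∉ A) (z : Finset σ → ι → S) :
    koszulHomotopy k z (insert k A) = koszulSign k A • divVar k (z A) := by
  rw [koszulHomotopy, if_pos (Finset.mem_insert_self k A), Finset.erase_insert hk]

theorem koszulHomotopy_mem {B : Submodule S (ι → S)} {k : σ} (hB : ∀ m ∈ B, divVar k m ∈ B)
    {z : Finset σ → ι → S} (hz : ∀ A, z A ∈ B) (A : Finset σ) : koszulHomotopy k z A ∈ B := by
  unfold koszulHomotopy
  split_ifs
  · exact zsmul_mem (hB _ (hz _)) _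
  · exact B.zero_mem

theorem coeff_omitVar (k : σ) (z : Finset σ → ι → S) (A : Finset σ) (l : ι) (u : σ →₀ ℕ) :
    coeff u (omitVar k z A l) = if k ∉ A ∧ u k = 0 then coeff u (z A l) else 0 := by
  by_cases h : k ∈ A <;> simp [omitVar, h, coeff_modVar]

variable [Fintype σ]

local notation "∂" => koszulD (X : σ → S)

theorem koszulD_koszulHomotopy_of_notMem {k : σ} {A : Finset σ} (hk : k ∉ A)
    (z : Finset σ → ι → S) : ∂ (koszulHomotopy k z) A = (X k : S) • divVar k (z A) := by
  rw [koszulD_apply, Finset.sum_eq_single k]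
  · rw [koszulHomotopy_insert hk, smul_comm (X k : S), smul_smul, koszulSign_mul_self, one_smul]
  · intro l _ hl
    rw [koszulHomotopy, if_neg (by simp [hk, hl.symm]), smul_zero, smul_zero]
  · exact fun h => absurd (Finset.mem_compl.2 hk) h

theorem koszulD_koszulHomotopy_insert {k : σ} {A : Finset σ} (hk : k ∉ A)
    (z : Finset σ → ι → S) : ∂ (koszulHomotopy k z) (insert k A) =
      -∑ l ∈ (insert k A)ᶜ,
        (koszulSign k A * koszulSign l A) • (X l : S) • divVar k (z (insert l A)) := by
  rw [koszulD_apply, ← Finset.sum_neg_distrib]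
  refine Finset.sum_congr rfl fun l hl => ?_
  obtain ⟨hlk, hl⟩ : l ≠ k ∧ l ∉ A := by
    simpa only [Finset.mem_compl, Finset.mem_insert, not_or] using hl
  rw [Finset.insert_comm l k, koszulHomotopy_insert (by simp [hk, hlk.symm]),
    smul_comm (X l : S), smul_smul, koszulSign_insert_mul_insert hk hl hlk.symm, neg_smul]

theorem koszulHomotopy_koszulD_insert {k : σ} {A : Finset σ} (hk : k ∉ A)
    (z : Finset σ → ι → S) : koszulHomotopy k (∂ z) (insert k A) = z (insert k A) +
      ∑ l ∈ (insert k A)ᶜ,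
        (koszulSign k A * koszulSign l A) • (X l : S) • divVar k (z (insert l A)) := by
  have compl_eq : Aᶜ = insert k (insert k A)ᶜ := by
    rw [Finset.compl_insert, Finset.insert_erase (Finset.mem_compl.2 hk)]
  rw [koszulHomotopy_insert hk, koszulD_apply, compl_eq,
    Finset.sum_insert (by simp), map_add, map_sum, smul_add, map_zsmul, divVar_X_smul,
    smul_smul, koszulSign_mul_self, one_smul, Finset.smul_sum]
  congr 1
  refine Finset.sum_congr rfl fun l hl => ?_
  have hkl : k ≠ l := by
    rintro rfl
    simp at hl
  rw [map_zsmul, divVar_X_smul_of_ne hkl, smul_smul]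

theorem koszulHomotopy_spec (k : σ) (z : Finset σ → ι → S) :
    ∂ (koszulHomotopy k z) + koszulHomotopy k (∂ z) + omitVar k z = z := by
  funext A
  rw [Pi.add_apply, Pi.add_apply]
  by_cases hk : k ∈ A
  · obtain ⟨B, hB, rfl⟩ : ∃ B, k ∉ B ∧ insert k B = A :=
      ⟨A.erase k, Finset.notMem_erase k A, Finset.insert_erase hk⟩
    rw [koszulD_koszulHomotopy_insert hB, koszulHomotopy_koszulD_insert hB, omitVar, if_pos hk,
      add_zero, add_comm (z _), neg_add_cancel_left]
  · rw [koszulD_koszulHomotopy_of_notMem hk, koszulHomotopy, if_neg hk, omitVar, if_neg hk,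
      add_zero, X_smul_divVar_add_modVar]

theorem exists_koszulD_add_eq_of_divVar_mem (T : Finset σ) {B B' : Submodule S (ι → S)}
    (hBB' : B' ≤ B) (hB : ∀ k ∈ T, ∀ m ∈ B, divVar k m ∈ B)
    (hB' : ∀ k ∈ T, ∀ m ∈ B', divVar k m ∈ B') {z : Finset σ → ι → S} (hz : ∀ A, z A ∈ B)
    (hdz : ∀ A, ∂ z A ∈ B') :
    ∃ v w r : Finset σ → ι → S, ∂ v + w + r = z ∧ (∀ A, v A ∈ B) ∧ (∀ A, r A ∈ B') ∧
      ∀ A l, ∀ u ∈ (w A l).support, u ∈ (z A l).support ∧ ∀ k ∈ T, k ∉ A ∧ u k = 0 := by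
  induction T using Finset.induction_on with
  | empty => exact ⟨0, z, 0, by simp, fun _ => B.zero_mem, fun _ => B'.zero_mem,
      fun A l u hu => ⟨hu, by simp⟩⟩
  | insert k T _ ih =>
    obtain ⟨v, w, r, rfl, hv, hr, hw⟩ := ih (fun k hk => hB k (Finset.mem_insert_of_mem hk))
      (fun k hk => hB' k (Finset.mem_insert_of_mem hk))
    have hkT := Finset.mem_insert_self k T
    have w_mem (A : Finset σ) : w A ∈ B := by
      have := B.sub_mem (B.sub_mem (hz A) (hBB' (hr A))) (koszulD_mem X hv A)
      simpa using this
    have koszulD_w_mem (A : Finset σ) : ∂ w A ∈ B' := by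
      have := B'.sub_mem (hdz A) (koszulD_mem X hr A)
      simpa [koszulD_koszulD] using this
    refine ⟨v + koszulHomotopy k w, omitVar k w, koszulHomotopy k (∂ w) + r, ?_,
      fun A => B.add_mem (hv A) (koszulHomotopy_mem (hB k hkT) w_mem A),
      fun A => B'.add_mem (koszulHomotopy_mem (hB' k hkT) koszulD_w_mem A) (hr A),
      fun A l u hu => ?_⟩
    · conv_rhs => rw [← koszulHomotopy_spec k w]
      rw [map_add]
      abel
    · rw [mem_support_iff, coeff_omitVar, ite_ne_right_iff] at hu
      obtain ⟨hz, hT⟩ := hw A l u (mem_support_iff.2 hu.2)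
      exact ⟨hz, Finset.forall_mem_insert .. |>.2 ⟨hu.1, hT⟩⟩

theorem exists_koszulD_eq {z : Finset σ → ι → S} (hz : ∂ z = 0)
    (hz₀ : ∀ l, constantCoeff (z ∅ l) = 0) : ∃ v, ∂ v = z := by
  obtain ⟨v, w, r, hvwr, -, hr, hw⟩ := exists_koszulD_add_eq_of_divVar_mem Finset.univ
    (B := ⊤) (B' := ⊥) (z := z) bot_le (fun _ _ _ _ => trivial) (by simp) (fun _ => trivial)
    (by simp [hz])
  have w_eq_zero : w = 0 := by
    ext A l u
    by_contra hu
    obtain ⟨hz, hT⟩ := hw A l u (mem_support_iff.2 hu)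
    obtain rfl : A = ∅ := Finset.eq_empty_of_forall_notMem fun k => (hT k (Finset.mem_univ k)).1
    obtain rfl : u = 0 := Finsupp.ext fun k => (hT k (Finset.mem_univ k)).2
    exact mem_support_iff.1 hz (hz₀ l)
  have r_eq_zero : r = 0 := funext hr
  exact ⟨v, by simpa [w_eq_zero, r_eq_zero] using hvwr⟩

end Homotopy

section KoszulHomology

variable {σ R ι κ : Type*} [LinearOrder σ] [Fintype σ] [CommRing R]

local notation "S" => MvPolynomial σ R
local notation "∂" => koszulD (X : σ → S)

/-- Vanishing of the Koszul homology of a graded submodule `B` of `⊕ l, S(-deg l)` in homological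
degree `p` and internal degree `p + q`. For a minimal graded free resolution of `B`, this means
that there is no basis element of degree `p + q` in homological degree `p`. -/
def KoszulAcyclic (deg : ι → ℕ) (B : Submodule S (ι → S)) (p q : ℕ) : Prop :=
  ∀ z : Finset σ → ι → S, (∀ A, z A ∈ B) → ∂ z = 0 →
    ∃ w : Finset σ → ι → S, (∀ A, w A ∈ B) ∧ ∂ w = bihomPart deg p q z

/-- Vanishing of the Koszul homology of the quotient `B ⧸ B'` of graded submodules of
`⊕ l, S(-deg l)` in homological degree `p` and internal degree `p + q`. -/
def KoszulAcyclicMod (deg : ι → ℕ) (B B' : Submodule S (ι → S)) (p q : ℕ) : Prop :=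
  ∀ z : Finset σ → ι → S, (∀ A, z A ∈ B) → (∀ A, ∂ z A ∈ B') →
    ∃ v : Finset σ → ι → S, (∀ A, v A ∈ B) ∧ ∀ A, (bihomPart deg p q z - ∂ v) A ∈ B'

theorem KoszulAcyclic.of_mod {deg : ι → ℕ} {B B' : Submodule S (ι → S)} (hBB' : B' ≤ B)
    (hB' : IsGraded deg B') {p q : ℕ} (hB : KoszulAcyclic deg B p (q + 1))
    (hmod : KoszulAcyclicMod deg B B' (p + 1) q) : KoszulAcyclic deg B' p (q + 1) := by
  intro z hz hdz
  obtain ⟨w, hw, hdw⟩ := hB z (fun A => hBB' (hz A)) hdz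
  obtain ⟨v, -, hv⟩ := hmod w hw fun A => hdw ▸ bihomPart_mem hB' hz A
  refine ⟨_, hv, ?_⟩
  rw [map_sub, koszulD_koszulD, sub_zero, koszulD_bihomPart_succ, hdw, bihomPart_bihomPart]

theorem KoszulAcyclic.of_sub {deg : ι → ℕ} {B B' : Submodule S (ι → S)} (hBB' : B' ≤ B)
    (hB : IsGraded deg B) {p q : ℕ} (hB' : KoszulAcyclic deg B' p (q + 1))
    (hmod : KoszulAcyclicMod deg B B' p (q + 1)) : KoszulAcyclic deg B p (q + 1) := by
  intro z hz hdz
  obtain ⟨v, hv, hvB'⟩ := hmod z hz fun A => by rw [hdz]; exact B'.zero_mem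
  obtain ⟨w, hw, hdw⟩ := hB' _ hvB' (by
    rw [map_sub, koszulD_koszulD, koszulD_bihomPart_eq_zero p (q + 1) hdz, sub_zero])
  refine ⟨w + bihomPart deg (p + 1) q v,
    fun A => B.add_mem (hBB' (hw A)) (bihomPart_mem hB hv A), ?_⟩
  rw [map_add, hdw, bihomPart_sub, bihomPart_bihomPart, koszulD_bihomPart_succ, sub_add_cancel]

theorem coeff_koszulD_eq_zero {A : Finset σ} {u : σ →₀ ℕ} (hu : ∀ k ∉ A, u k = 0)
    (z : Finset σ → ι → S) (l : ι) : coeff u (∂ z A l) = 0 := by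
  rw [koszulD_apply, Finset.sum_apply, coeff_sum]
  refine Finset.sum_eq_zero fun k hk => ?_
  have hX : coeff u (X k * z (insert k A) l) = 0 := by
    rw [coeff_X_mul', if_neg (by simpa using hu k (Finset.mem_compl.1 hk))]
  rw [Pi.smul_apply, Pi.smul_apply, smul_eq_mul, coeff_smul, hX, smul_zero]

theorem not_koszulAcyclic_of_coeff_ne_zero {deg : ι → ℕ} {B : Submodule S (ι → S)}
    (hB : NoConstantTerm B) {y : Finset σ → ι → S} (hdy : ∀ A, ∂ y A ∈ B) {T : Finset σ} {p : ℕ}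
    (hT : T.card = p + 1) {u : σ →₀ ℕ} (hu : ∀ k ∉ T, u k = 0) {l : ι}
    (hBu : ∀ m ∈ B, coeff u (m l) = 0) (hyu : coeff u (y T l) ≠ 0) :
    ¬ KoszulAcyclic deg B p (u.degree + deg l + 1) := by
  intro h
  obtain ⟨w, hw, hdw⟩ := h (∂ y) hdy (koszulD_koszulD X y)
  set y' := bihomPart deg (p + 1) (u.degree + deg l) y with hy'
  rw [← koszulD_bihomPart_succ, eq_comm, ← sub_eq_zero, ← map_sub] at hdw
  obtain ⟨x, hx⟩ := exists_koszulD_eq hdw fun i => by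
    rw [Pi.sub_apply, bihomPart_of_card_ne (by simp), zero_sub, Pi.neg_apply, map_neg,
      hB _ (hw ∅) i, neg_zero]
  have coeff_y' : coeff u (y' T l) = coeff u (y T l) := by
    rw [hy', bihomPart, if_pos hT, coeff_gradedPart, if_pos rfl]
  have coeff_sub_eq_zero := coeff_koszulD_eq_zero hu x l
  rw [hx, Pi.sub_apply, Pi.sub_apply, coeff_sub, hBu _ (hw T), sub_zero, coeff_y']
    at coeff_sub_eq_zero
  exact hyu coeff_sub_eq_zero

variable [Finite κ] [DecidableEq κ] {deg : ι → ℕ} {deg' : κ → ℕ}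
  {f : (κ → MvPolynomial σ R) →ₗ[MvPolynomial σ R] (ι → MvPolynomial σ R)}

theorem KoszulAcyclic.ker_of_range (hf : IsHomogeneousMap deg' deg f)
    (hmin : NoConstantTerm (LinearMap.ker f)) {p q : ℕ}
    (h : KoszulAcyclic deg (LinearMap.range f) (p + 1) q) :
    KoszulAcyclic deg' (LinearMap.ker f) p (q + 1) := by
  intro z hz hdz
  set y := bihomPart deg' p (q + 1) z with hy
  have y_mem (A : Finset σ) : y A ∈ LinearMap.ker f := bihomPart_mem hf.isGraded_ker hz A
  obtain ⟨v, hv⟩ : ∃ v, ∂ v = y :=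
    exists_koszulD_eq (koszulD_bihomPart_eq_zero p (q + 1) hdz) (hmin _ (y_mem ∅))
  set v' := bihomPart deg' (p + 1) q v
  have koszulD_v' : ∂ v' = y := by rw [koszulD_bihomPart_succ, hv, hy, bihomPart_bihomPart]
  obtain ⟨w, hw, hdw⟩ := h (f ∘ v') (fun A => LinearMap.mem_range_self f _)
    (by rw [koszulD_comp, koszulD_v']; exact funext y_mem)
  choose x hx using hw
  obtain rfl : f ∘ x = w := funext hx
  rw [bihomPart_comp hf, bihomPart_bihomPart, koszulD_comp] at hdw
  refine ⟨v' - ∂ x, fun A => ?_, by rw [map_sub, koszulD_koszulD, koszulD_v', sub_zero]⟩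
  rw [Pi.sub_apply, LinearMap.mem_ker, map_sub, sub_eq_zero]
  exact (congrFun hdw A).symm

theorem KoszulAcyclic.range_of_ker (hf : IsHomogeneousMap deg' deg f)
    (hmin : NoConstantTerm (LinearMap.ker f)) {p q : ℕ}
    (h : KoszulAcyclic deg' (LinearMap.ker f) p (q + 1)) :
    KoszulAcyclic deg (LinearMap.range f) (p + 1) q := by
  intro z hz hdz
  choose x hx using hz
  obtain rfl : f ∘ x = z := funext hx
  rw [koszulD_comp] at hdz
  obtain ⟨w, hw, hdw⟩ := h (∂ x) (congrFun hdz) (koszulD_koszulD X x)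
  rw [← koszulD_bihomPart_succ, eq_comm, ← sub_eq_zero, ← map_sub] at hdw
  obtain ⟨v, hv⟩ := exists_koszulD_eq hdw fun l => by
    rw [Pi.sub_apply, bihomPart_of_card_ne (by simp), zero_sub, Pi.neg_apply, map_neg,
      hmin _ (hw ∅) l, neg_zero]
  refine ⟨f ∘ v, fun A => LinearMap.mem_range_self f _, ?_⟩
  rw [koszulD_comp, hv, bihomPart_comp hf]
  funext A
  simp only [Function.comp_apply, Pi.sub_apply, map_sub, LinearMap.mem_ker.1 (hw A), sub_zero]

theorem koszulAcyclic_range_succ_iff (hf : IsHomogeneousMap deg' deg f)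
    (hmin : NoConstantTerm (LinearMap.ker f)) {p q : ℕ} :
    KoszulAcyclic deg (LinearMap.range f) (p + 1) q ↔
      KoszulAcyclic deg' (LinearMap.ker f) p (q + 1) :=
  ⟨.ker_of_range hf hmin, .range_of_ker hf hmin⟩

theorem koszulAcyclic_range_zero_iff [Nontrivial R] (hf : IsHomogeneousMap deg' deg f)
    (hmin : NoConstantTerm (LinearMap.ker f)) {q : ℕ} :
    KoszulAcyclic deg (LinearMap.range f) 0 q ↔ ∀ k, deg' k ≠ q := by
  refine ⟨?_, fun h z hz hdz => ?_⟩
  · rintro h k rfl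
    set x := bihomPart deg' 0 (deg' k) fun _ => (Pi.single k 1 : κ → S) with hx
    have x_empty : x ∅ = Pi.single k 1 := by
      rw [hx, bihomPart, if_pos Finset.card_empty,
        (isHomogeneousElt_single deg' k).gradedPart_eq, if_pos rfl]
    obtain ⟨w, hw, hdw⟩ := h (f ∘ x) (fun A => LinearMap.mem_range_self f _)
      (by rw [koszulD_comp, koszulD_bihomPart_zero]; exact funext fun _ => map_zero f)
    choose y hy using hw
    obtain rfl : f ∘ y = w := funext hy
    rw [bihomPart_comp hf, bihomPart_bihomPart, koszulD_comp] at hdw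
    have constantCoeff_eq_zero := hmin (x ∅ - ∂ y ∅)
      (by rw [LinearMap.mem_ker, map_sub, sub_eq_zero]; exact (congrFun hdw ∅).symm) k
    rw [Pi.sub_apply, map_sub, constantCoeff_eq, coeff_koszulD_eq_zero (by simp), x_empty]
      at constantCoeff_eq_zero
    simp at constantCoeff_eq_zero
  · choose x hx using hz
    obtain rfl : f ∘ x = z := funext hx
    obtain ⟨v, hv⟩ := exists_koszulD_eq (koszulD_bihomPart_zero deg' q x) fun l => by
      rw [bihomPart, if_pos Finset.card_empty, constantCoeff_eq, coeff_gradedPart,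
        if_neg (by simpa using h l)]
    refine ⟨f ∘ v, fun A => LinearMap.mem_range_self f _, ?_⟩
    rw [koszulD_comp, hv, bihomPart_comp hf]

end KoszulHomology

section Resolutions

/-- An ideal as a submodule of the free module of rank one. -/
def idealSubmodule {A : Type*} [CommRing A] (I : Ideal A) : Submodule A (Fin 1 → A) :=
  Submodule.comap (LinearMap.proj 0) I

theorem mem_idealSubmodule {A : Type*} [CommRing A] {I : Ideal A} {m : Fin 1 → A} :
    m ∈ idealSubmodule I ↔ m 0 ∈ I :=
  Iff.rfl

variable {K : Type*} [Field K] {n : ℕ} {I : Ideal (MvPolynomial (Fin n) K)}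

namespace MinimalGradedFreeResolution

variable (F : MinimalGradedFreeResolution I)

theorem range_pi_aug :
    LinearMap.range (LinearMap.pi fun _ : Fin 1 => F.aug) = idealSubmodule I := by
  ext m
  refine Iff.trans (exists_congr fun x => ?_) (SetLike.ext_iff.1 F.range_aug (m 0))
  refine ⟨fun h => congrFun h 0, fun h => funext fun l => ?_⟩
  rw [Subsingleton.elim l 0]
  exact h

theorem ker_pi_aug : LinearMap.ker (LinearMap.pi fun _ : Fin 1 => F.aug) = LinearMap.ker F.aug := by
  rw [LinearMap.ker_pi, iInf_const]

theorem noConstantTerm_range_d (i : ℕ) : NoConstantTerm (LinearMap.range (F.d i)) := by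
  rintro _ ⟨x, rfl⟩ l
  rw [← LinearMap.sum_single_apply _ x, map_sum, Finset.sum_apply, map_sum]
  refine Finset.sum_eq_zero fun k _ => ?_
  rw [← mul_one (x k), ← smul_eq_mul, Pi.single_smul, map_smul, Pi.smul_apply, smul_eq_mul, map_mul,
    F.minimal, mul_zero]

theorem isHomogeneousMap_d (i : ℕ) : IsHomogeneousMap (F.deg (i + 1)) (F.deg i) (F.d i) :=
  fun k l => F.d_homogeneous i k l

theorem noConstantTerm_ker_d (i : ℕ) : NoConstantTerm (LinearMap.ker (F.d i)) :=
  F.exact_succ i ▸ F.noConstantTerm_range_d (i + 1)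

theorem isHomogeneousMap_pi_aug :
    IsHomogeneousMap (F.deg 0) (fun _ => 0) (LinearMap.pi fun _ : Fin 1 => F.aug) :=
  fun k _ => F.aug_homogeneous k

theorem noConstantTerm_ker_pi_aug :
    NoConstantTerm (LinearMap.ker (LinearMap.pi fun _ : Fin 1 => F.aug)) := by
  rw [ker_pi_aug, ← F.exact_zero]
  exact F.noConstantTerm_range_d 0

theorem betti_eq_zero_iff (i j : ℕ) : F.betti i j = 0 ↔ ∀ k, F.deg i k ≠ j := by
  simp [betti, Finset.filter_eq_empty_iff]

theorem koszulAcyclic_range_d_iff (i p q : ℕ) :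
    KoszulAcyclic (F.deg i) (LinearMap.range (F.d i)) p q ↔ F.betti (i + p + 1) (p + q) = 0 := by
  induction p generalizing i q with
  | zero =>
    rw [koszulAcyclic_range_zero_iff (F.isHomogeneousMap_d i) (F.noConstantTerm_ker_d i),
      zero_add, betti_eq_zero_iff, add_zero]
  | succ p ih =>
    rw [koszulAcyclic_range_succ_iff (F.isHomogeneousMap_d i) (F.noConstantTerm_ker_d i),
      ← F.exact_succ, ih, add_right_comm i, add_assoc i p, add_comm q, add_assoc p]

theorem koszulAcyclic_iff (p q : ℕ) :
    KoszulAcyclic (fun _ => 0) (idealSubmodule I) p q ↔ F.betti p (p + q) = 0 := by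
  rw [← F.range_pi_aug]
  cases p with
  | zero =>
    rw [koszulAcyclic_range_zero_iff F.isHomogeneousMap_pi_aug F.noConstantTerm_ker_pi_aug,
      betti_eq_zero_iff, zero_add]
  | succ p =>
    rw [koszulAcyclic_range_succ_iff F.isHomogeneousMap_pi_aug F.noConstantTerm_ker_pi_aug,
      ker_pi_aug, ← F.exact_zero, koszulAcyclic_range_d_iff, zero_add, add_right_comm, add_assoc]

end MinimalGradedFreeResolution

/-- The graded Koszul homology of `I` in homological degree `p` and internal degree `p + q`
vanishes for all `p` and all `q > r`, but not for `q = r` and all `p`. -/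
def HasKoszulRegularity {σ R : Type*} [LinearOrder σ] [Fintype σ] [CommRing R]
    (I : Ideal (MvPolynomial σ R)) (r : ℕ) : Prop :=
  (∀ p q, r < q → KoszulAcyclic (fun _ => 0) (idealSubmodule I) p q) ∧
    ∃ p, ¬ KoszulAcyclic (fun _ => 0) (idealSubmodule I) p r

theorem HasKoszulRegularity.isGreatest {r : ℕ} (h : HasKoszulRegularity I r)
    (F : MinimalGradedFreeResolution I) :
    IsGreatest {e : ℤ | ∃ i j : ℕ, F.betti i j ≠ 0 ∧ e = (j : ℤ) - (i : ℤ)} r := by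
  obtain ⟨p, hp⟩ := h.2
  refine ⟨⟨p, p + r, mt (F.koszulAcyclic_iff p r).2 hp, by simp⟩, ?_⟩
  rintro _ ⟨i, j, hij, rfl⟩
  by_contra! hlt
  obtain ⟨q, rfl⟩ : ∃ q, j = i + q := ⟨j - i, by omega⟩
  exact hij ((F.koszulAcyclic_iff i q).1 (h.1 i q (by omega)))

end Resolutions

section Existence

theorem mem_span_image_compl_of_sum_smul_eq_zero {κ A M : Type*} [Fintype κ] [Ring A]
    [AddCommGroup M] [Module A M] {b : κ → M} {m : κ → A} (h : ∑ x, m x • b x = 0) {k : κ}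
    (hk : IsUnit (m k)) : b k ∈ Submodule.span A (b '' {k}ᶜ) := by
  classical
  rw [← Submodule.smul_mem_iff_of_isUnit _ hk,
    eq_neg_of_add_eq_zero_left ((Finset.add_sum_erase _ _ (Finset.mem_univ k)).trans h)]
  exact neg_mem (sum_mem fun x hx => Submodule.smul_mem _ _
    (Submodule.subset_span ⟨x, Finset.ne_of_mem_erase hx, rfl⟩))

section

variable {σ R ι : Type*} [CommRing R] {deg : ι → ℕ}
  {B : Submodule (MvPolynomial σ R) (ι → MvPolynomial σ R)}

local notation "S" => MvPolynomial σ R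

theorem IsGraded.span_homogeneous [Finite ι] (hB : IsGraded deg B) :
    Submodule.span S {m | m ∈ B ∧ ∃ j, IsHomogeneousElt deg j m} = B := by
  refine le_antisymm (Submodule.span_le.2 fun m hm => hm.1) fun m hm => ?_
  obtain ⟨J, hJ⟩ := exists_sum_gradedPart deg m
  rw [hJ]
  exact sum_mem fun j _ => Submodule.subset_span
    ⟨hB j m hm, j, isHomogeneousElt_gradedPart deg j m⟩

theorem IsGraded.exists_minimal_generators [Finite ι] [Finite σ] [IsNoetherianRing R]
    (hB : IsGraded deg B) :
    ∃ (t : ℕ) (b : Fin t → ι → S), (∀ k, ∃ j, IsHomogeneousElt deg j (b k)) ∧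
      Submodule.span S (Set.range b) = B ∧ ∀ k, b k ∉ Submodule.span S (b '' {k}ᶜ) := by
  classical
  have exists_generators : ∃ s : Finset (ι → S),
      (∀ m ∈ s, ∃ j, IsHomogeneousElt deg j m) ∧ Submodule.span S (s : Set (ι → S)) = B := by
    have hfg : B.FG := IsNoetherian.noetherian B
    rw [← hB.span_homogeneous, Submodule.fg_span_iff_fg_span_finset_subset] at hfg
    obtain ⟨s, hs, hspan⟩ := hfg
    exact ⟨s, fun m hm => (hs hm).2, hspan ▸ hB.span_homogeneous⟩
  obtain ⟨s, ⟨hs, hspan⟩, hmin⟩ := exists_minimal_of_wellFoundedLT _ exists_generators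
  let b (k : Fin s.card) : ι → S := s.equivFin.symm k
  have range_b : Set.range b = s := by
    rw [show b = Subtype.val ∘ s.equivFin.symm from rfl, s.equivFin.symm.surjective.range_comp]
    exact Subtype.range_coe
  refine ⟨s.card, b, fun k => hs _ (s.equivFin.symm k).2, range_b.symm ▸ hspan, fun k hk => ?_⟩
  have b_mem : b k ∈ s := (s.equivFin.symm k).2
  have b_injective : Function.Injective b :=
    Subtype.val_injective.comp s.equivFin.symm.injective
  have image_b : b '' {k}ᶜ = s.erase (b k) := by
    rw [Set.image_compl_eq_range_sdiff_image b_injective, range_b, Set.image_singleton,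
      Finset.coe_erase]
  rw [image_b] at hk
  have span_erase : Submodule.span S (s.erase (b k) : Set (ι → S)) = B := by
    rw [← hspan, ← Finset.insert_erase b_mem, Finset.coe_insert, Finset.erase_insert_eq_erase,
      Finset.erase_idem, Submodule.span_insert_eq_span hk]
  exact Finset.notMem_erase _ _
    (hmin ⟨fun m hm => hs m (Finset.mem_of_mem_erase hm), span_erase⟩ (s.erase_subset _) b_mem)

end

variable {K : Type*} [Field K]

theorem IsGraded.exists_minimal_cover {σ ι : Type*} [Finite σ] [Finite ι] {deg : ι → ℕ}
    {B : Submodule (MvPolynomial σ K) (ι → MvPolynomial σ K)} (hB : IsGraded deg B) :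
    ∃ (t : ℕ) (deg' : Fin t → ℕ)
      (f : (Fin t → MvPolynomial σ K) →ₗ[MvPolynomial σ K] (ι → MvPolynomial σ K)),
      IsHomogeneousMap deg' deg f ∧ LinearMap.range f = B ∧ NoConstantTerm (LinearMap.ker f) := by
  obtain ⟨t, b, hb, hspan, hmin⟩ := hB.exists_minimal_generators
  choose deg' hdeg' using hb
  let f := Fintype.linearCombination (MvPolynomial σ K) b
  have hf : IsHomogeneousMap deg' deg f := fun k => by
    rw [Fintype.linearCombination_apply_single, one_smul]
    exact hdeg' k
  refine ⟨t, deg', f, hf, by rw [Fintype.range_linearCombination, hspan], fun m hm k => ?_⟩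
  by_contra hk
  refine hmin k (mem_span_image_compl_of_sum_smul_eq_zero (m := gradedPart deg' (deg' k) m) ?_ ?_)
  · exact hf.isGraded_ker (deg' k) m hm
  · rw [gradedPart_apply_self]
    exact (isUnit_iff_ne_zero.2 hk).map C

/-- A graded submodule of a finite free module `⊕ l, S(-deg l)` over `S = K[x_1, …, x_n]`: a stage
in the construction of a free resolution. -/
structure GradedSubmodule (K : Type*) [Field K] (n : ℕ) where
  rank : ℕ
  deg : Fin rank → ℕ
  module : Submodule (MvPolynomial (Fin n) K) (Fin rank → MvPolynomial (Fin n) K)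
  graded : IsGraded deg module

variable {n : ℕ}

theorem GradedSubmodule.exists_syzygies (s : GradedSubmodule K n) :
    ∃ (s' : GradedSubmodule K n)
      (f : (Fin s'.rank → MvPolynomial (Fin n) K) →ₗ[MvPolynomial (Fin n) K]
        (Fin s.rank → MvPolynomial (Fin n) K)),
      IsHomogeneousMap s'.deg s.deg f ∧ LinearMap.range f = s.module ∧
        LinearMap.ker f = s'.module ∧ NoConstantTerm s'.module := by
  obtain ⟨t, deg', f, hf, hr, hmin⟩ := s.graded.exists_minimal_cover
  exact ⟨⟨t, deg', LinearMap.ker f, hf.isGraded_ker⟩, f, hf, hr, rfl, hmin⟩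

theorem nonempty_minimalGradedFreeResolution {I : Ideal (MvPolynomial (Fin n) K)}
    (hI : IsGraded (fun _ => 0) (idealSubmodule I)) :
    Nonempty (MinimalGradedFreeResolution I) := by
  choose next f hf hrange hker hmin using fun s : GradedSubmodule K n => s.exists_syzygies
  let s₀ : GradedSubmodule K n := ⟨1, fun _ => 0, idealSubmodule I, hI⟩
  let s : ℕ → GradedSubmodule K n := Nat.rec (next s₀) fun _ => next
  have noConstantTerm : ∀ i, NoConstantTerm (s i).module
    | 0 => hmin s₀
    | i + 1 => hmin (s i)
  refine ⟨{
    rank i := (s i).rank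
    deg i := (s i).deg
    aug := LinearMap.proj 0 ∘ₗ f s₀
    d i := f (s i)
    range_aug := ?_
    exact_zero := (hrange (s 0)).trans ((hker s₀).symm.trans ?_)
    exact_succ i := (hrange (s (i + 1))).trans (hker (s i)).symm
    aug_homogeneous k := hf s₀ k (0 : Fin 1)
    d_homogeneous i k l := hf (s i) k l
    minimal i k l := noConstantTerm i _ (hrange (s i) ▸ LinearMap.mem_range_self _ _) l }⟩
  · rw [LinearMap.range_comp, hrange]
    exact Submodule.map_comap_eq_of_surjective (LinearEquiv.funUnique (Fin 1) _ _).surjective I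
  · exact (LinearMap.ker_comp_of_ker_eq_bot _
      (LinearMap.ker_eq_bot.2 (LinearEquiv.funUnique (Fin 1) _ _).injective)).symm

end Existence

section MonomialIdeals

variable {σ R : Type*} [CommRing R] {I J : Ideal (MvPolynomial σ R)} {E F : Set (σ →₀ ℕ)}

local notation "S" => MvPolynomial σ R

/-- `I` is the monomial ideal spanned by the monomials with exponents in `E`: it consists of the
polynomials all of whose exponents lie in `E`. -/
def HasExponents (I : Ideal S) (E : Set (σ →₀ ℕ)) : Prop :=
  ∀ f, f ∈ I ↔ ∀ u ∈ f.support, u ∈ E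

theorem hasExponents_top : HasExponents (⊤ : Ideal S) Set.univ := by
  simp [HasExponents]

theorem HasExponents.inf (hI : HasExponents I E) (hJ : HasExponents J F) :
    HasExponents (I ⊓ J) (E ∩ F) := by
  intro f
  rw [Submodule.mem_inf, hI, hJ]
  exact forall₂_and.symm

theorem hasExponents_iInf {α : Sort*} {I : α → Ideal S} {E : α → Set (σ →₀ ℕ)}
    (h : ∀ x, HasExponents (I x) (E x)) : HasExponents (⨅ x, I x) (⋂ x, E x) := by
  intro f
  simp only [Submodule.mem_iInf, Set.mem_iInter, h _ f]
  exact ⟨fun h u hu x => h x u hu, fun h x u hu => h u hu x⟩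

theorem HasExponents.monomial_mem (hI : HasExponents I E) {u : σ →₀ ℕ} (hu : u ∈ E) (c : R) :
    monomial u c ∈ I := by
  rw [hI]
  intro v hv
  rwa [Finset.mem_singleton.1 (support_monomial_subset hv)]

theorem HasExponents.coeff_eq_zero (hI : HasExponents I E) {f : S} (hf : f ∈ I) {u : σ →₀ ℕ}
    (hu : u ∉ E) : coeff u f = 0 :=
  notMem_support_iff.1 fun h => hu ((hI f).1 hf u h)

theorem HasExponents.isGraded (hI : HasExponents I E) :
    IsGraded (fun _ => 0) (idealSubmodule I) := by
  intro j m hm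
  rw [mem_idealSubmodule, hI] at hm ⊢
  refine fun u hu => hm u ?_
  rw [mem_support_iff, coeff_gradedPart, ite_ne_right_iff] at hu
  exact mem_support_iff.2 hu.2

theorem HasExponents.divVar_mem (hI : HasExponents I E) {k : σ}
    (hk : ∀ u, Finsupp.single k 1 + u ∈ E → u ∈ E) {m : Fin 1 → S} (hm : m ∈ idealSubmodule I) :
    divVar k m ∈ idealSubmodule I := by
  rw [mem_idealSubmodule, hI] at hm ⊢
  intro u hu
  rw [mem_support_iff] at hu
  exact hk u (hm _ (mem_support_iff.2 hu))

/-- The exponents of the monomials in the irreducible ideal `(x_j ^ a j : j ∈ T)`. -/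
def irredExponents (T : Finset σ) (a : σ → ℕ) : Set (σ →₀ ℕ) :=
  {u | ∃ j ∈ T, a j ≤ u j}

theorem mem_irredExponents_of_single_add {T : Finset σ} {a : σ → ℕ} {k : σ} (hk : k ∉ T)
    {u : σ →₀ ℕ} (hu : Finsupp.single k 1 + u ∈ irredExponents T a) : u ∈ irredExponents T a := by
  obtain ⟨j, hj, haj⟩ := hu
  have hjk : j ≠ k := ne_of_mem_of_not_mem hj hk
  rw [Finsupp.add_apply, Finsupp.single_eq_of_ne hjk, zero_add] at haj
  exact ⟨j, hj, haj⟩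

theorem hasExponents_span_X_pow (T : Finset σ) (a : σ → ℕ) :
    HasExponents (Ideal.span ((fun j => X j ^ a j : σ → S) '' T)) (irredExponents T a) := by
  intro f
  have image_eq : (fun j => X j ^ a j : σ → S) '' T =
      (fun u => monomial u (1 : R)) '' ((fun j => Finsupp.single j (a j)) '' T) := by
    rw [Set.image_image]
    exact Set.image_congr fun j _ => X_pow_eq_monomial
  simp [image_eq, mem_ideal_span_monomial_image, irredExponents]

/-- The exponent of the monomial `∏ j ∈ T, x_j ^ (a j - 1)`, which generates the socle of
`K[x_j : j ∈ T] / (x_j ^ a j : j ∈ T)`. -/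
noncomputable def socleExponent (T : Finset σ) (a : σ → ℕ) : σ →₀ ℕ :=
  Finsupp.indicator T fun j _ => a j - 1

/-- The regularity of the ideal `(x_j ^ a j : j ∈ T)`. -/
def irredReg (T : Finset σ) (a : σ → ℕ) : ℕ :=
  ∑ j ∈ T, (a j - 1) + 1

variable {T : Finset σ} {a : σ → ℕ}

theorem degree_socleExponent_add_one (T : Finset σ) (a : σ → ℕ) :
    (socleExponent T a).degree + 1 = irredReg T a := by
  have sum_eq : (socleExponent T a).degree = ∑ j ∈ T, (a j - 1) :=
    (Finset.sum_subset (Finsupp.support_indicator_subset T _) fun j _ hj =>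
      Finsupp.notMem_support_iff.1 hj).trans
      (Finset.sum_congr rfl fun j hj => Finsupp.indicator_of_mem hj _)
  rw [sum_eq, irredReg]

theorem notMem_irredExponents_of_le_socleExponent (ha : ∀ j ∈ T, 0 < a j) {u : σ →₀ ℕ}
    (hu : u ≤ socleExponent T a) : u ∉ irredExponents T a := by
  rintro ⟨j, hj, haj⟩
  have huj := hu j
  rw [socleExponent, Finsupp.indicator_of_mem hj] at huj
  have := ha j hj
  omega

theorem le_socleExponent {u : σ →₀ ℕ} (hu : u ∉ irredExponents T a) (huT : ∀ k ∉ T, u k = 0) :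
    u ≤ socleExponent T a := by
  intro j
  by_cases hj : j ∈ T
  · rw [socleExponent, Finsupp.indicator_of_mem hj]
    by_contra hlt
    exact hu ⟨j, hj, by omega⟩
  · rw [huT j hj]
    exact Nat.zero_le _

theorem single_add_socleExponent_mem {k : σ} (hk : k ∈ T) :
    Finsupp.single k 1 + socleExponent T a ∈ irredExponents T a := by
  refine ⟨k, hk, ?_⟩
  rw [Finsupp.add_apply, Finsupp.single_eq_same, socleExponent, Finsupp.indicator_of_mem hk]
  omega

end MonomialIdeals

section Regularity

variable {σ R : Type*} [LinearOrder σ] [Fintype σ] [CommRing R] {I J : Ideal (MvPolynomial σ R)}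
  {E : Set (σ →₀ ℕ)} {T : Finset σ} {a : σ → ℕ}

local notation "S" => MvPolynomial σ R
local notation "∂" => koszulD (X : σ → S)

theorem koszulAcyclicMod_inf (hI : HasExponents I E) (hJ : HasExponents J (irredExponents T a))
    (hE : ∀ k ∉ T, ∀ u, Finsupp.single k 1 + u ∈ E → u ∈ E) {p q : ℕ} (hq : irredReg T a ≤ q) :
    KoszulAcyclicMod (fun _ => 0) (idealSubmodule I) (idealSubmodule (I ⊓ J)) p q := by
  intro z hz hdz
  have hIJ := hI.inf hJ
  obtain ⟨q, rfl⟩ : ∃ q', q = q' + 1 := ⟨q - 1, by rw [irredReg] at hq; omega⟩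
  obtain ⟨v, w, r, hvwr, hv, hr, hw⟩ := exists_koszulD_add_eq_of_divVar_mem Tᶜ
    (Submodule.comap_mono inf_le_left)
    (fun k hk _ => hI.divVar_mem (hE k (Finset.mem_compl.1 hk)))
    (fun k hk _ => hIJ.divVar_mem fun u hu => ⟨hE k (Finset.mem_compl.1 hk) u hu.1,
      mem_irredExponents_of_single_add (Finset.mem_compl.1 hk) hu.2⟩) hz hdz
  refine ⟨bihomPart (fun _ => 0) (p + 1) q v, bihomPart_mem hI.isGraded hv, fun A => ?_⟩
  rw [koszulD_bihomPart_succ, ← bihomPart_sub, ← hvwr, add_assoc, add_sub_cancel_left, bihomPart]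
  split_ifs
  swap
  · exact Submodule.zero_mem _
  rw [Pi.add_apply, map_add]
  refine Submodule.add_mem _ ?_ (hIJ.isGraded _ _ (hr A))
  rw [mem_idealSubmodule, hIJ]
  intro u hu
  rw [mem_support_iff, coeff_gradedPart, ite_ne_right_iff, ← mem_support_iff] at hu
  obtain ⟨huz, huT⟩ := hw A 0 u hu.2
  refine ⟨(hI _).1 (hz A) u huz, ?_⟩
  by_contra huE
  have degree_le := Finsupp.degree_mono
    (le_socleExponent huE fun k hk => (huT k (Finset.mem_compl.2 hk)).2)
  have := degree_socleExponent_add_one T a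
  omega

theorem not_koszulAcyclic_inf [Nontrivial R] (hI : HasExponents I E)
    (hJ : HasExponents J (irredExponents T a)) (ha : ∀ j ∈ T, 0 < a j)
    (hsocle : socleExponent T a ∈ E) {p : ℕ} (hT : T.card = p + 1) :
    ¬ KoszulAcyclic (fun _ => 0) (idealSubmodule (I ⊓ J)) p (irredReg T a) := by
  set y : Finset σ → Fin 1 → S := Pi.single T fun _ => monomial (socleExponent T a) 1 with hy
  have koszulD_y_mem (A : Finset σ) : ∂ y A ∈ idealSubmodule (I ⊓ J) := by
    rw [koszulD_apply]
    refine sum_mem fun k _ => zsmul_mem ?_ _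
    by_cases hA : insert k A = T
    · have hk : k ∈ T := hA ▸ Finset.mem_insert_self k A
      have X_mul_mem_left : X k * monomial (socleExponent T a) (1 : R) ∈ I :=
        I.mul_mem_left _ (hI.monomial_mem hsocle 1)
      have X_mul_mem_right : X k * monomial (socleExponent T a) (1 : R) ∈ J := by
        rw [X, monomial_mul]
        exact hJ.monomial_mem (single_add_socleExponent_mem hk) _
      rw [hy, hA, Pi.single_eq_same]
      exact ⟨X_mul_mem_left, X_mul_mem_right⟩
    · rw [hy, Pi.single_eq_of_ne hA, smul_zero]
      exact Submodule.zero_mem _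
  have coeff_mem_eq_zero {u : σ →₀ ℕ} (hu : u ≤ socleExponent T a) {f : S} (hf : f ∈ I ⊓ J) :
      coeff u f = 0 :=
    hJ.coeff_eq_zero hf.2 (notMem_irredExponents_of_le_socleExponent ha hu)
  have noConstantTerm : NoConstantTerm (idealSubmodule (I ⊓ J)) := by
    intro m hm l
    rw [Subsingleton.elim l 0]
    exact coeff_mem_eq_zero zero_le hm
  rw [← degree_socleExponent_add_one]
  exact not_koszulAcyclic_of_coeff_ne_zero (u := socleExponent T a) (l := 0) noConstantTerm
    koszulD_y_mem hT (fun k hk => Finsupp.indicator_of_notMem hk _)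
    (fun m hm => coeff_mem_eq_zero le_rfl hm)
    (by simp [hy, coeff_monomial])

theorem hasKoszulRegularity_top [Nontrivial R] : HasKoszulRegularity (⊤ : Ideal S) 0 := by
  refine ⟨fun p q hq z _ hz => ?_, 0, fun h => ?_⟩
  · obtain ⟨v, hv⟩ := exists_koszulD_eq (koszulD_bihomPart_eq_zero p q hz) fun l => by
      rw [bihomPart]
      split_ifs
      · rw [constantCoeff_eq, coeff_gradedPart, if_neg (by simpa using hq.ne)]
      · simp
    exact ⟨v, fun _ => trivial, hv⟩
  · obtain ⟨w, -, hw⟩ := h (Pi.single ∅ 1) (fun _ => trivial)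
      (funext fun A => by simp [koszulD_apply])
    have coeff_eq_zero := coeff_koszulD_eq_zero (A := ∅) (u := 0) (by simp) w 0
    rw [hw, bihomPart, if_pos Finset.card_empty, Pi.single_eq_same, coeff_gradedPart]
      at coeff_eq_zero
    simp at coeff_eq_zero

theorem HasKoszulRegularity.inf [Nontrivial R] {r : ℕ} (hr : HasKoszulRegularity I r)
    (hI : HasExponents I E) (hJ : HasExponents J (irredExponents T a)) (hT : T.Nonempty)
    (ha : ∀ j ∈ T, 0 < a j) (hE : ∀ k ∉ T, ∀ u, Finsupp.single k 1 + u ∈ E → u ∈ E)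
    (hsocle : socleExponent T a ∈ E) :
    HasKoszulRegularity (I ⊓ J) (max (irredReg T a) r) := by
  have hle : idealSubmodule (I ⊓ J) ≤ idealSubmodule I := Submodule.comap_mono inf_le_left
  refine ⟨fun p q hq => ?_, ?_⟩
  · obtain ⟨q, rfl⟩ : ∃ q', q = q' + 1 := ⟨q - 1, by omega⟩
    exact .of_mod hle (hI.inf hJ).isGraded (hr.1 p _ (by omega))
      (koszulAcyclicMod_inf hI hJ hE (by omega))
  · obtain h | h := le_or_gt r (irredReg T a)
    · rw [max_eq_left h]
      obtain ⟨p, hp⟩ : ∃ p, T.card = p + 1 := ⟨T.card - 1, by have := hT.card_pos; omega⟩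
      exact ⟨p, not_koszulAcyclic_inf hI hJ ha hsocle hp⟩
    · obtain ⟨p, hp⟩ := hr.2
      rw [max_eq_right h.le]
      obtain ⟨r, rfl⟩ : ∃ r', r = r' + 1 := ⟨r - 1, by omega⟩
      exact ⟨p, fun hIJ => hp (hIJ.of_sub hle hI.isGraded (koszulAcyclicMod_inf hI hJ hE h.le))⟩

end Regularity

section Chains

variable {σ R : Type*} [CommRing R] {m : ℕ} {Q : Fin (m + 1) → Ideal (MvPolynomial σ R)}
  {T : Fin (m + 1) → Finset σ} {a : Fin (m + 1) → σ → ℕ}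

theorem tailInter_last {A : Type*} [CommRing A] (Q : Fin (m + 1) → Ideal A) :
    tailInter Q (Fin.last m) = Q (Fin.last m) := by
  simp [tailInter, Fin.last_le_iff]

theorem tailInter_castSucc {A : Type*} [CommRing A] (Q : Fin (m + 1) → Ideal A) (i : Fin m) :
    tailInter Q i.castSucc = tailInter Q i.succ ⊓ Q i.castSucc := by
  refine le_antisymm (le_inf ?_ (iInf₂_le _ le_rfl)) (le_iInf₂ fun k hk => ?_)
  · exact le_iInf₂ fun k hk => iInf₂_le k (Fin.castSucc_lt_succ.le.trans hk)
  · obtain rfl | hlt := hk.eq_or_lt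
    · exact inf_le_right
    · exact inf_le_left.trans (iInf₂_le k (Fin.castSucc_lt_iff_succ_le.1 hlt))

theorem hasExponents_tailInter (hQ : ∀ k, HasExponents (Q k) (irredExponents (T k) (a k)))
    (i : Fin (m + 1)) :
    HasExponents (tailInter Q i) (⋂ k, ⋂ _ : i ≤ k, irredExponents (T k) (a k)) :=
  hasExponents_iInf fun k => hasExponents_iInf fun _ => hQ k

theorem mem_iInter_irredExponents_of_single_add (hT : Antitone T) {i l : Fin (m + 1)}
    (hil : l ≤ i) {k : σ} (hk : k ∉ T l) {u : σ →₀ ℕ}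
    (hu : Finsupp.single k 1 + u ∈ ⋂ k, ⋂ _ : i ≤ k, irredExponents (T k) (a k)) :
    u ∈ ⋂ k, ⋂ _ : i ≤ k, irredExponents (T k) (a k) := by
  rw [Set.mem_iInter₂] at hu ⊢
  exact fun k' hk' =>
    mem_irredExponents_of_single_add (fun h => hk (hT (hil.trans hk') h)) (hu k' hk')

/-- An exponent witnessing that `⋂ j ≠ i, Q j` is not contained in `Q i` is, on `T i`, bounded by
the socle exponent of `Q i`. -/
theorem socleExponent_mem_irredExponents
    (hQ : ∀ k, HasExponents (Q k) (irredExponents (T k) (a k))) (hT : Antitone T)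
    (hirr : Irredundant Q) {i k : Fin (m + 1)} (hik : i < k) :
    socleExponent (T i) (a i) ∈ irredExponents (T k) (a k) := by
  obtain ⟨f, hf, hfi⟩ := SetLike.not_le_iff_exists.1 (hirr i)
  rw [hQ i] at hfi
  push Not at hfi
  obtain ⟨u, hu, hui⟩ := hfi
  simp only [Submodule.mem_iInf] at hf
  obtain ⟨j, hj, haj⟩ := (hQ k f).1 (hf k hik.ne') u hu
  have hji := hT hik.le hj
  refine ⟨j, hj, ?_⟩
  rw [socleExponent, Finsupp.indicator_of_mem hji]
  by_contra hlt
  exact hui ⟨j, hji, by omega⟩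

theorem HasExponents.hasKoszulRegularity [LinearOrder σ] [Fintype σ] [Nontrivial R]
    {J : Ideal (MvPolynomial σ R)} {T : Finset σ} {a : σ → ℕ}
    (hJ : HasExponents J (irredExponents T a)) (hT : T.Nonempty) (ha : ∀ j ∈ T, 0 < a j) :
    HasKoszulRegularity J (irredReg T a) := by
  simpa using hasKoszulRegularity_top.inf hasExponents_top hJ hT ha (fun _ _ _ _ => trivial) trivial

theorem hasKoszulRegularity_tailInter [LinearOrder σ] [Fintype σ] [Nontrivial R]
    (hQ : ∀ k, HasExponents (Q k) (irredExponents (T k) (a k))) (hT : Antitone T)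
    (hT_nonempty : ∀ k, (T k).Nonempty) (ha : ∀ k, ∀ j ∈ T k, 0 < a k j) (hirr : Irredundant Q)
    (i : Fin (m + 1)) :
    HasKoszulRegularity (tailInter Q i) ((Finset.Ici i).sup fun k => irredReg (T k) (a k)) := by
  induction i using Fin.reverseInduction with
  | last =>
    have Ici_last : Finset.Ici (Fin.last m) = {Fin.last m} := Finset.Ici_top
    rw [Ici_last, Finset.sup_singleton, tailInter_last]
    exact (hQ _).hasKoszulRegularity (hT_nonempty _) (ha _)
  | cast i ih =>
    have Ici_castSucc : Finset.Ici i.castSucc = insert i.castSucc (Finset.Ici i.succ) := by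
      ext k
      rw [Finset.mem_insert, Finset.mem_Ici, Finset.mem_Ici, ← Fin.castSucc_lt_iff_succ_le,
        le_iff_eq_or_lt, eq_comm]
    rw [Ici_castSucc, Finset.sup_insert, tailInter_castSucc]
    refine ih.inf (hasExponents_tailInter hQ _) (hQ _) (hT_nonempty _) (ha _)
      (fun k hk u => mem_iInter_irredExponents_of_single_add hT Fin.castSucc_lt_succ.le hk) ?_
    exact Set.mem_iInter₂.2 fun k hk =>
      socleExponent_mem_irredExponents hQ hT hirr (Fin.castSucc_lt_iff_succ_le.2 hk)

theorem sup_irredReg_eq (hT : Antitone T)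
    (hmono : ∀ (i : Fin m), ∀ j ∈ T i.succ, a i.succ j ≤ a i.castSucc j) (i : Fin (m + 1)) :
    ((Finset.Ici i).sup fun k => irredReg (T k) (a k)) = irredReg (T i) (a i) := by
  have antitone : Antitone fun k => irredReg (T k) (a k) := by
    refine Fin.antitone_iff_succ_le.2 fun i => Nat.add_le_add_right ?_ 1
    exact (Finset.sum_le_sum fun j hj => Nat.sub_le_sub_right (hmono i j hj) 1).trans
      (Finset.sum_le_sum_of_subset (hT Fin.castSucc_lt_succ.le))
  exact le_antisymm (Finset.sup_le fun k hk => antitone (Finset.mem_Ici.1 hk))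
    (Finset.le_sup (f := fun k => irredReg (T k) (a k)) (Finset.mem_Ici.2 le_rfl))

end Chains

section InitialSegments

variable {K : Type*} [Field K] {n : ℕ}

theorem HasKoszulRegularity.hasRegularity {I : Ideal (MvPolynomial (Fin n) K)}
    {E : Set (Fin n →₀ ℕ)} {r : ℕ} (hr : HasKoszulRegularity I r) (hI : HasExponents I E) :
    HasRegularity I r :=
  ⟨nonempty_minimalGradedFreeResolution hI.isGraded, hr.isGreatest⟩

/-- The indices of the variables `x_1, …, x_r` among `x_1, …, x_n`. -/
def initialVars (n r : ℕ) : Finset (Fin n) :=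
  {j | (j : ℕ) < r}

theorem mem_initialVars {r : ℕ} {j : Fin n} : j ∈ initialVars n r ↔ (j : ℕ) < r := by
  simp [initialVars]

theorem initialVars_mono : Monotone (initialVars n) :=
  fun _ _ h _ hj => mem_initialVars.2 ((mem_initialVars.1 hj).trans_le h)

theorem initialVars_nonempty {r : ℕ} (hr : 1 ≤ r) (hrn : r ≤ n) : (initialVars n r).Nonempty :=
  ⟨⟨0, by omega⟩, mem_initialVars.2 hr⟩

theorem hasExponents_irredIdeal (r : ℕ) (a : Fin n → ℕ) :
    HasExponents (irredIdeal K r a) (irredExponents (initialVars n r) a) := by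
  have span_eq : irredIdeal K r a =
      Ideal.span ((fun j => MvPolynomial.X j ^ a j) '' initialVars n r) :=
    congrArg Ideal.span (Set.ext fun p => by simp [mem_initialVars, eq_comm])
  exact span_eq ▸ hasExponents_span_X_pow (initialVars n r) a

theorem cast_irredReg_initialVars {r : ℕ} {a : Fin n → ℕ} (hrn : r ≤ n)
    (ha : ∀ j ∈ initialVars n r, 0 < a j) :
    (irredReg (initialVars n r) a : ℤ) =
      ∑ j ∈ Finset.univ.filter (fun j : Fin n => (j : ℕ) < r), (a j : ℤ) - r + 1 := by
  have cast_sub_one : ∀ j ∈ initialVars n r, ((a j - 1 : ℕ) : ℤ) = a j - 1 :=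
    fun j hj => Nat.cast_pred (ha j hj)
  have card_initialVars : (initialVars n r).card = r := by
    rw [initialVars, Fin.card_filter_val_lt, min_eq_right hrn]
  rw [irredReg, Nat.cast_add_one, Nat.cast_sum, Finset.sum_congr rfl cast_sub_one,
    Finset.sum_sub_distrib, Finset.sum_const, card_initialVars, nsmul_one, initialVars]

end InitialSegments

theorem corollary1p5_general {K : Type*} [Field K] {n m : ℕ} {N : Fin (m + 1) → ℕ}
    (hN : Antitone N) (hN_le : ∀ i, N i ≤ n) (hN_pos : ∀ i, 1 ≤ N i)
    {a : Fin (m + 1) → Fin n → ℕ} (ha : ∀ i, ∀ j ∈ initialVars n (N i), 0 < a i j)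
    (hirr : Irredundant fun i => irredIdeal K (N i) (a i)) (i : Fin (m + 1)) :
    HasRegularity (tailInter (fun k => irredIdeal K (N k) (a k)) i)
        ((Finset.Ici i).sup fun k => irredReg (initialVars n (N k)) (a k) : ℕ) ∧
      HasRegularity (irredIdeal K (N i) (a i)) (irredReg (initialVars n (N i)) (a i)) := by
  have hQ := fun k => hasExponents_irredIdeal (K := K) (N k) (a k)
  have hT_nonempty := fun k => initialVars_nonempty (hN_pos k) (hN_le k)
  have reg_tailInter :=
    hasKoszulRegularity_tailInter hQ (initialVars_mono.comp_antitone hN) hT_nonempty ha hirr i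
  have reg_irredIdeal := (hQ i).hasKoszulRegularity (hT_nonempty i) (ha i)
  exact ⟨reg_tailInter.hasRegularity (hasExponents_tailInter hQ i),
    reg_irredIdeal.hasRegularity (hQ i)⟩

end BorelType

theorem corollary1p5 {K : Type*} [Field K] (n m : ℕ) (N : Fin (m + 1) → ℕ)
    (hN : StrictAnti N) (hN_le : ∀ i, N i ≤ n) (hN_pos : ∀ i, 1 ≤ N i)
    (a : Fin (m + 1) → Fin n → ℕ)
    (ha : ∀ (i : Fin (m + 1)) (j : Fin n), (j : ℕ) < N i → 0 < a i j)
    (hirr : BorelType.Irredundant fun i => BorelType.irredIdeal K (N i) (a i))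
    (hmono : ∀ (i : Fin m) (j : Fin n), (j : ℕ) < N i.succ → a i.succ j ≤ a i.castSucc j)
    (i : Fin (m + 1)) :
    BorelType.HasRegularity
        (BorelType.tailInter (fun k => BorelType.irredIdeal K (N k) (a k)) i)
        ((∑ j ∈ Finset.univ.filter (fun j : Fin n => (j : ℕ) < N i), (a i j : ℤ)) - (N i : ℤ) + 1) ∧
      BorelType.HasRegularity (BorelType.irredIdeal K (N i) (a i))
        ((∑ j ∈ Finset.univ.filter (fun j : Fin n => (j : ℕ) < N i), (a i j : ℤ)) - (N i : ℤ) + 1) := by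
  simp only [← BorelType.mem_initialVars] at ha hmono
  have sup_eq := BorelType.sup_irredReg_eq (T := fun k => BorelType.initialVars n (N k))
    (BorelType.initialVars_mono.comp_antitone hN.antitone) hmono i
  simpa only [sup_eq, BorelType.cast_irredReg_initialVars (hN_le i) (ha i)] using
    BorelType.corollary1p5_general hN.antitone hN_le hN_pos ha hirr i
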